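/- For each $n\ge 1$ let $m=m(n)\ge 0$ be an integer and let $\boldsymbol p=(p_{11},p_{10},p_{01},p_{00})$ and $\boldsymbol q=(q_{11},q_{10},q_{01},q_{00})$ be probability vectors, all of which may depend on $n$. The attributed Erdős–Rényi pair $\mathcal G(n,\boldsymbol p;m,\boldsymbol q)$ is a pair $(G_1,G_2)$ of random graphs on the same $n$ user vertices and $m$ attribute vertices, without edges between attributes. Write $G_k(e)\in\{0,1\}$ for the indicator that the vertex pair $e$ is an edge of $G_k$. The pairs $(G_1(e),G_2(e))$ are independent over all vertex pairs $e$; $(G_1(e),G_2(e))=(i,j)$ has probability $p_{ij}$ if $e$ is an unordered pair of distinct users, and probability $q_{ij}$ if $e$ consists of a user and an attribute. Let $\Pi^*$ be a uniformly random permutation of the users, independent of $(G_1,G_2)$, and let $G_2'$ be obtained from $G_2$ by re-labelling each user $i$ as $\Pi^*(i)$. An estimator is a function $\hat\pi(G_1,G_2')$ whose values are permutations of the users; it may depend on $n,m,\boldsymbol p,\boldsymbol q$. **Theorem (Achievability).** Assume that user-user edges are positively correlated, i.e. their correlation coefficient $$\rho_{\mathrm u}=\frac{p_{11}-(p_{11}+p_{10})(p_{11}+p_{01})}{\sqrt{(p_{11}+p_{10})(1-p_{11}-p_{10})}\,\sqrt{(p_{11}+p_{01})(1-p_{11}-p_{01})}}$$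 is well defined and positive, and that user-attribute edges have non-negative covariance, $q_{11}-(q_{11}+q_{10})(q_{11}+q_{01})\ge 0$. Assume that, as $n\to\infty$, $$1-(p_{11}+p_{10})=\Theta(1),\qquad 1-(p_{11}+p_{01})=\Theta(1),\qquad \rho_{\mathrm u}=\Theta(1).$$ If $$n\,p_{11}+m\,\psi_{\mathrm a}-\log n\to\infty,\qquad\text{where } \psi_{\mathrm a}=\bigl(\sqrt{q_{11}q_{00}}-\sqrt{q_{10}q_{01}}\bigr)^2,$$ then exact alignment is achievable with high probability: there are estimators $\hat\pi=\hat\pi_n$ with $$\lim_{n\to\infty}\mathsf P\bigl(\hat\pi(G_1,G_2')\ne\Pi^*\bigr)=0.$$ Moreover, this holds for every maximum a posteriori (MAP) estimator, i.e. every estimator whose value maximizes the posterior probability of $\Pi^*$ given $(G_1,G_2')$, however ties are broken. -/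

import Mathlib

open Filter Asymptotics

namespace AttributedAlignment

noncomputable section

/-- A joint law of a pair `(X, Y)` of `{0,1}`-valued random variables:
`pij` is the probability of `(X, Y) = (i, j)`. -/
structure PairLaw where
  p11 : ℝ
  p10 : ℝ
  p01 : ℝ
  p00 : ℝ
  p11_nonneg : 0 ≤ p11
  p10_nonneg : 0 ≤ p10
  p01_nonneg : 0 ≤ p01
  p00_nonneg : 0 ≤ p00
  sum_eq_one : p11 + p10 + p01 + p00 = 1

namespace PairLaw

/-- The probability mass function of the pair. -/
def prob (L : PairLaw) : Bool → Bool → ℝ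
  | true, true => L.p11
  | true, false => L.p10
  | false, true => L.p01
  | false, false => L.p00

/-- `P(X = 1) = E[X] = E[X ^ 2]`. -/
def mean₁ (L : PairLaw) : ℝ := L.p11 + L.p10

/-- `P(Y = 1) = E[Y] = E[Y ^ 2]`. -/
def mean₂ (L : PairLaw) : ℝ := L.p11 + L.p01

/-- `Var[X] = E[X ^ 2] - E[X] ^ 2`. -/
def var₁ (L : PairLaw) : ℝ := L.mean₁ - L.mean₁ ^ 2

/-- `Var[Y] = E[Y ^ 2] - E[Y] ^ 2`. -/
def var₂ (L : PairLaw) : ℝ := L.mean₂ - L.mean₂ ^ 2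

/-- `Cov(X, Y) = E[X Y] - E[X] E[Y]`. -/
def cov (L : PairLaw) : ℝ := L.p11 - L.mean₁ * L.mean₂

/-- The correlation coefficient of `X` and `Y`. -/
def corr (L : PairLaw) : ℝ := L.cov / (√L.var₁ * √L.var₂)

/-- `(√(p11 p00) - √(p10 p01)) ^ 2`. -/
def psi (L : PairLaw) : ℝ := (√(L.p11 * L.p00) - √(L.p10 * L.p01)) ^ 2

end PairLaw

/-- User-user vertex pairs: unordered pairs of distinct users. -/
abbrev UserPair (n : ℕ) : Type := {e : Sym2 (Fin n) // ¬ e.IsDiag}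

/-- User-attribute vertex pairs. -/
abbrev AttrPair (n m : ℕ) : Type := Fin n × Fin m

/-- The vertex pairs that may carry an edge (there are no attribute-attribute edges). -/
abbrev VertexPair (n m : ℕ) : Type := UserPair n ⊕ AttrPair n m

/-- An attributed graph with `n` users and `m` attributes, as the indicator of its edges. -/
abbrev AttributedGraph (n m : ℕ) : Type := VertexPair n m → Bool

/-- The map induced on vertex pairs by a permutation of the users (attributes are fixed). -/
def permPair {n m : ℕ} (π : Equiv.Perm (Fin n)) : VertexPair n m → VertexPair n m
  | Sum.inl e => Sum.inl ⟨Sym2.map π e.1, fun h => e.2 ((Sym2.isDiag_map π.injective).1 h)⟩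
  | Sum.inr (i, v) => Sum.inr (π i, v)

/-- The graph `π(g)` in which each user `i` of `g` is re-labelled as `π i`: the pair `e` is an
edge of `π(g)` iff `π⁻¹ e` is an edge of `g`. -/
def relabel {n m : ℕ} (π : Equiv.Perm (Fin n)) (g : AttributedGraph n m) :
    AttributedGraph n m :=
  fun e => g (permPair π⁻¹ e)

/-- `P(G₁ = g₁, G₂ = g₂)` for the attributed Erdős–Rényi pair: the pairs `(G₁(e), G₂(e))` are
independent over the vertex pairs `e`, with law `p` for user-user pairs and law `q` for
user-attribute pairs. -/
def graphPairProb {n m : ℕ} (p q : PairLaw) (g₁ g₂ : AttributedGraph n m) : ℝ :=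
  (∏ e : UserPair n, p.prob (g₁ (Sum.inl e)) (g₂ (Sum.inl e))) *
    ∏ e : AttrPair n m, q.prob (g₁ (Sum.inr e)) (g₂ (Sum.inr e))

/-- `P(Π* = π, G₁ = g₁, G₂ = g₂)`, where `Π*` is a uniformly random permutation of the users that
is independent of `(G₁, G₂)`. -/
def jointProb {n m : ℕ} (p q : PairLaw) (_π : Equiv.Perm (Fin n))
    (g₁ g₂ : AttributedGraph n m) : ℝ :=
  (Fintype.card (Equiv.Perm (Fin n)) : ℝ)⁻¹ * graphPairProb p q g₁ g₂

/-- An estimator of the permutation: a function of the observed pair `(G₁, G₂')`. -/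
abbrev Estimator (n m : ℕ) : Type :=
  AttributedGraph n m → AttributedGraph n m → Equiv.Perm (Fin n)

/-- `P(est(G₁, G₂') ≠ Π*)`, where `G₂' = Π*(G₂)` is the anonymized graph. -/
def errorProb {n m : ℕ} (p q : PairLaw) (est : Estimator n m) : ℝ :=
  ∑ π : Equiv.Perm (Fin n), ∑ g₁ : AttributedGraph n m, ∑ g₂ : AttributedGraph n m,
    if est g₁ (relabel π g₂) ≠ π then jointProb p q π g₁ g₂ else 0

/-- `P(Π* = π, G₁ = g₁, G₂' = h)`, where `G₂' = Π*(G₂)`. -/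
def observedProb {n m : ℕ} (p q : PairLaw) (π : Equiv.Perm (Fin n))
    (g₁ h : AttributedGraph n m) : ℝ :=
  ∑ g₂ : AttributedGraph n m, if relabel π g₂ = h then jointProb p q π g₁ g₂ else 0

/-- The posterior probability `P(Π* = π | G₁ = g₁, G₂' = h)` (zero for all `π` if the observation
`(g₁, h)` has probability zero). -/
def posterior {n m : ℕ} (p q : PairLaw) (g₁ h : AttributedGraph n m)
    (π : Equiv.Perm (Fin n)) : ℝ :=
  observedProb p q π g₁ h / ∑ σ : Equiv.Perm (Fin n), observedProb p q σ g₁ h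

/-- A maximum a posteriori (MAP) estimator, with an arbitrary rule for breaking ties. -/
def IsMAP {n m : ℕ} (p q : PairLaw) (est : Estimator n m) : Prop :=
  ∀ (g₁ h : AttributedGraph n m) (π : Equiv.Perm (Fin n)),
    posterior p q g₁ h π ≤ posterior p q g₁ h (est g₁ h)

end

end AttributedAlignment

/-!
Why the theorem holds. A MAP estimator fails only if some `τ ≠ 1` makes `(G₁, τ(G₂))` at least as
likely as `(G₁, G₂)`, so the error probability is controlled by a union bound over `τ` in which the
indicator of `P' ≥ P`, times `P`, is replaced by `√(P * P')` (`errorProb_le_sum_add_sum`). The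
resulting Bhattacharyya sum factors along the cycles of the action of `τ` on the vertex pairs; an
inequality of Finner type (`sum_prod_perm_le`, proved by eliminating one site at a time) bounds it
by one factor per moved pair, the Hilbert–Schmidt norm `√(1 - 2ψ) ≤ exp (-ψ)` of the
`2 × 2` overlap matrix. If `τ` moves `k` users, it moves `m k` user-attribute pairs and about
`k (n - k / 2)` user-user pairs, so that its term is at most
`exp (-k (ψ_u (n - k / 2) + m ψ_a))` up to lower order terms, while there are at most `n ^ k` such
`τ`.

Bounded correlation makes `ψ_u` of order `p11`. If `p11 ≥ A log n / n` with a large constant `A`,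
the user-user part alone suffices (`errorProb_le_of_dense`). If `p11 ≤ A log n / n`, then
`n ψ_u = n p11 - o(1)`, and with `s = n p11 + m ψ_a - log n → ∞` the bound suffices as long as
`k p11 ≤ s`. For larger `k` the loss of `k / 2` in `n - k / 2` matters. There one first excludes
the event that some large set `S` of users has fewer than a quarter of the expected number of
common edges touching it, which costs `32 / s` (`sum_exp_card_touching_le`). Off that event every
common edge may be given weight `exp 4`: this gains a factor `exp (-p11)` per user pair touching
the moved users, while it changes the norm of the overlap matrix only by a factor
`exp (O(p11 ^ (3/2)))` (`PairLaw.hsNorm_overlap_le`, `errorProb_le_of_sparse`).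
-/

open Filter Asymptotics

namespace AttributedAlignment

noncomputable section

/-! ### A Finner-type inequality along a permutation -/

theorem sum_option_pi {α β : Type*} [Fintype α] [DecidableEq α]
    [DecidableEq (Option α)] [Fintype β]
    (F : (Option α → β) → ℝ) :
    ∑ g, F g = ∑ g : α → β, ∑ x : β, F (fun o => o.elim x g) := by
  rw [Finset.sum_comm,
    ← Fintype.sum_prod_type' (f := fun (x : β) (g : α → β) => F (fun o => o.elim x g))]
  refine Fintype.sum_equiv (Equiv.piOptionEquivProd (β := fun _ => β)) _ _ fun g => ?_
  congr 1
  funext o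
  cases o <;> rfl

/-- The Hilbert–Schmidt norm of a square matrix. -/
def hsNorm {β : Type*} [Fintype β] (A : β → β → ℝ) : ℝ := √(∑ x, ∑ y, A x y ^ 2)

theorem hsNorm_nonneg {β : Type*} [Fintype β] (A : β → β → ℝ) : 0 ≤ hsNorm A := Real.sqrt_nonneg _

theorem sum_mul_swap_le_hsNorm {β : Type*} [Fintype β] (A B : β → β → ℝ) :
    ∑ x, ∑ y, A x y * B y x ≤ hsNorm A * hsNorm B := by
  have h := Real.sum_mul_le_sqrt_mul_sqrt Finset.univ
    (fun z : β × β => A z.1 z.2) (fun z : β × β => B z.2 z.1)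
  simp only [Fintype.sum_prod_type] at h
  rwa [Finset.sum_comm (f := fun x y => B y x ^ 2)] at h

theorem hsNorm_mul_le {β : Type*} [Fintype β] (A B : β → β → ℝ) :
    hsNorm (fun x y => ∑ z, A x z * B z y) ≤ hsNorm A * hsNorm B := by
  unfold hsNorm
  rw [← Real.sqrt_mul (by positivity)]
  refine Real.sqrt_le_sqrt ?_
  rw [Finset.sum_comm (f := fun x y => B x y ^ 2), Finset.sum_mul_sum]
  exact Finset.sum_le_sum fun x _ => Finset.sum_le_sum fun y _ =>
    Finset.sum_mul_sq_le_sq_mul_sq _ _ _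

open Classical in
/-- The contribution of the site `e` to the bound `sum_prod_perm_le`: the trace of `B e` if `f`
fixes `e`, its Hilbert–Schmidt norm if `f` moves `e`. -/
def siteFactor {β : Type*} [Fintype β] {E : Type*} (f : Equiv.Perm E) (B : E → β → β → ℝ)
    (e : E) : ℝ :=
  if f e = e then ∑ x, B e x x else hsNorm (B e)

theorem siteFactor_of_eq {β : Type*} [Fintype β] {E : Type*} {f : Equiv.Perm E}
    {B : E → β → β → ℝ} {e : E} (h : f e = e) : siteFactor f B e = ∑ x, B e x x := if_pos h

theorem siteFactor_of_ne {β : Type*} [Fintype β] {E : Type*} {f : Equiv.Perm E}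
    {B : E → β → β → ℝ} {e : E} (h : f e ≠ e) : siteFactor f B e = hsNorm (B e) := if_neg h

theorem siteFactor_nonneg {β : Type*} [Fintype β] {E : Type*} (f : Equiv.Perm E)
    {B : E → β → β → ℝ} (hB : ∀ e x y, 0 ≤ B e x y) (e : E) : 0 ≤ siteFactor f B e := by
  unfold siteFactor
  split_ifs
  · exact Finset.sum_nonneg fun x _ => hB _ _ _
  · exact hsNorm_nonneg _

open Classical in
/-- Each variable `g e` occurs in exactly two factors, so that for a permutation without fixed
points this is a Brascamp–Lieb inequality of Finner type. The induction removes one site `none`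
from the cycle through it, which merges the matrices of `none` and of its predecessor into their
product. -/
theorem sum_prod_perm_le {β : Type*} [Fintype β] {E : Type*} [Fintype E] [DecidableEq E]
    (f : Equiv.Perm E) (B : E → β → β → ℝ) (hB : ∀ e x y, 0 ≤ B e x y) :
    ∑ g : E → β, ∏ e, B e (g e) (g (f e)) ≤
      ∏ e, siteFactor f B e := by
  -- The induction runs over all finite types, hence with classical decidability of equality.
  suffices h : ∀ (f : Equiv.Perm E) (B : E → β → β → ℝ), (∀ e x y, 0 ≤ B e x y) →
      @Finset.sum (E → β) ℝ _ (@Finset.univ _ (@Pi.instFintype E _ (Classical.decEq E) _ _))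
        (fun g => ∏ e, B e (g e) (g (f e))) ≤ ∏ e, siteFactor f B e by
    convert h f B hB
  clear hB f B
  refine Fintype.induction_empty_option (P := fun E _ => ∀ (f : Equiv.Perm E)
    (B : E → β → β → ℝ), (∀ e x y, 0 ≤ B e x y) → ∑ g : E → β, ∏ e, B e (g e) (g (f e)) ≤
      ∏ e, siteFactor f B e) ?_ ?_ ?_ E
  · intro α α' _ e ih f B hB
    let _ := Fintype.ofEquiv α' e.symm
    have h := ih ((e.trans f).trans e.symm) (fun a => B (e a)) (fun a => hB (e a))
    convert h using 1
    · refine Fintype.sum_equiv (Equiv.arrowCongr e.symm (Equiv.refl β)) _ _ fun g => ?_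
      refine Fintype.prod_equiv e.symm _ _ fun a => ?_
      simp
    · refine Fintype.prod_equiv e.symm _ _ fun a => ?_
      simp [siteFactor]
  · intro f B _
    simp
  · intro α _ ih f B hB
    rw [@sum_option_pi, Fintype.prod_option]
    simp only [Fintype.prod_option, Option.elim_none, Option.elim_some]
    set f' := Equiv.removeNone f with hf'
    by_cases h0 : f none = none
    · have hf : ∀ a, f (some a) = some (f' a) := by
        intro a
        refine (Equiv.removeNone_some f ?_).symm
        rcases h : f (some a) with _ | b
        · rw [← h0] at h
          exact absurd (f.injective h) (by simp)
        · exact ⟨b, rfl⟩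
      have hs : ∀ a, siteFactor f B (some a) = siteFactor f' (fun a => B (some a)) a := by
        intro a
        simp only [siteFactor, hf, Option.some_inj]
      rw [siteFactor_of_eq h0]
      simp only [hf, h0, hs, Option.elim_none, Option.elim_some]
      simp_rw [← Finset.sum_mul]
      rw [← Finset.mul_sum]
      exact mul_le_mul_of_nonneg_left (ih f' _ fun a => hB _)
        (Finset.sum_nonneg fun x _ => hB _ _ _)
    · obtain ⟨c, hc⟩ := Option.ne_none_iff_exists'.1 h0
      obtain ⟨d, hd⟩ : ∃ d, f (some d) = none := by
        rcases h : f.symm none with _ | d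
        · exact absurd ((Equiv.symm_apply_eq f).1 h).symm h0
        · exact ⟨d, ((Equiv.symm_apply_eq f).1 h).symm⟩
      have hf : ∀ a, a ≠ d → f (some a) = some (f' a) := by
        intro a ha
        refine (Equiv.removeNone_some f ?_).symm
        rcases h : f (some a) with _ | b
        · rw [← hd] at h
          exact absurd (Option.some_inj.1 (f.injective h)) ha
        · exact ⟨b, rfl⟩
      have hfd : f' d = c := by
        have := Equiv.removeNone_none f hd
        rw [hc] at this
        exact Option.some_inj.1 this
      set B' : α → β → β → ℝ := Function.update (fun a => B (some a)) d
        (fun x y => ∑ z, B (some d) x z * B none z y) with hB'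
      have hBd : B' d = fun x y => ∑ z, B (some d) x z * B none z y := by simp [hB']
      have hBa : ∀ a, a ≠ d → B' a = B (some a) := fun a ha => by simp [hB', ha]
      have hB0 : ∀ a x y, 0 ≤ B' a x y := by
        intro a x y
        by_cases ha : a = d
        · subst ha
          rw [hBd]
          exact Finset.sum_nonneg fun z _ => mul_nonneg (hB _ _ _) (hB _ _ _)
        · rw [hBa a ha]
          exact hB _ _ _
      have key := ih f' B' hB0
      have hL : ∀ g : α → β, ∑ x, B none x ((f none).elim x g) *
          ∏ a, B (some a) (g a) ((f (some a)).elim x g) = ∏ a, B' a (g a) (g (f' a)) := by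
        intro g
        rw [← Finset.mul_prod_erase _ _ (Finset.mem_univ d), hBd, hfd, Finset.sum_mul]
        refine Finset.sum_congr rfl fun x _ => ?_
        rw [← Finset.mul_prod_erase _ _ (Finset.mem_univ d), hc, hd]
        simp only [Option.elim_none, Option.elim_some]
        rw [← mul_assoc, mul_comm (B none x (g c))]
        congr 1
        refine Finset.prod_congr rfl fun a ha => ?_
        have ha' := Finset.ne_of_mem_erase ha
        rw [hf a ha', hBa a ha', Option.elim_some]
      simp_rw [hL]
      refine key.trans ?_
      rw [← Finset.mul_prod_erase _ _ (Finset.mem_univ d),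
        ← Finset.mul_prod_erase _ (fun a => siteFactor f B (some a)) (Finset.mem_univ d),
        ← mul_assoc]
      have hrest : ∀ a ∈ Finset.univ.erase d,
          siteFactor f' B' a = siteFactor f B (some a) := by
        intro a ha
        have ha' := Finset.ne_of_mem_erase ha
        unfold siteFactor
        rw [hf a ha', hBa a ha']
        simp only [Option.some_inj]
      rw [Finset.prod_congr rfl hrest]
      refine mul_le_mul_of_nonneg_right ?_
        (Finset.prod_nonneg fun a _ => siteFactor_nonneg f hB _)
      have hd' : f (some d) ≠ some d := by
        rw [hd]
        exact (Option.some_ne_none d).symm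
      rw [siteFactor_of_ne h0, siteFactor_of_ne hd', mul_comm]
      unfold siteFactor
      rw [hBd]
      split_ifs
      · exact sum_mul_swap_le_hsNorm _ _
      · exact hsNorm_mul_le _ _

/-! ### Overlap matrices of a pair law -/

namespace PairLaw

theorem prob_nonneg (L : PairLaw) (x y : Bool) : 0 ≤ L.prob x y := by
  cases x <;> cases y
  exacts [L.p00_nonneg, L.p01_nonneg, L.p10_nonneg, L.p11_nonneg]

/-- The matrix `B y y' = ∑ x, w x y * √(L x y * L x y')`, where the weight `w x y` is `z` if
`x = y = 1` and `1` otherwise. For `z = 1` it collects the Bhattacharyya overlaps of the rows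
`L · y` and `L · y'`; a larger `z` tilts the law towards common edges. -/
def overlap (L : PairLaw) (z : ℝ) (y y' : Bool) : ℝ :=
  ∑ x, (if x && y then z else 1) * √(L.prob x y * L.prob x y')

theorem overlap_nonneg (L : PairLaw) {z : ℝ} (hz : 0 ≤ z) (y y' : Bool) :
    0 ≤ L.overlap z y y' :=
  Finset.sum_nonneg fun x _ => mul_nonneg (by split_ifs <;> positivity) (Real.sqrt_nonneg _)

theorem sum_overlap_self (L : PairLaw) (z : ℝ) :
    ∑ y, L.overlap z y y = 1 + (z - 1) * L.p11 := by
  have := L.sum_eq_one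
  simp only [overlap, Fintype.sum_bool, prob, Real.sqrt_mul_self L.p11_nonneg,
    Real.sqrt_mul_self L.p10_nonneg, Real.sqrt_mul_self L.p01_nonneg,
    Real.sqrt_mul_self L.p00_nonneg]
  simp
  linarith

theorem sum_overlap_sq (L : PairLaw) (z : ℝ) :
    ∑ y, ∑ y', L.overlap z y y' ^ 2 =
      (z * √L.p11 ^ 2 + √L.p01 ^ 2) ^ 2 + (z * (√L.p11 * √L.p10) + √L.p01 * √L.p00) ^ 2 +
        ((√L.p11 * √L.p10 + √L.p01 * √L.p00) ^ 2 + (√L.p10 ^ 2 + √L.p00 ^ 2) ^ 2) := by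
  simp only [overlap, Fintype.sum_bool, prob, Real.sqrt_mul L.p11_nonneg,
    Real.sqrt_mul L.p10_nonneg, Real.sqrt_mul L.p01_nonneg, Real.sqrt_mul L.p00_nonneg]
  simp
  ring

/-- The symmetric matrix `overlap 1` has trace `1` and determinant `psi`, so that the square of its
Hilbert–Schmidt norm is `1 - 2 * psi`. -/
theorem hsNorm_overlap_one_le (L : PairLaw) : hsNorm (L.overlap 1) ≤ Real.exp (-L.psi) := by
  have h : ∑ y, ∑ y', L.overlap 1 y y' ^ 2 = 1 - 2 * L.psi := by
    rw [sum_overlap_sq, psi, Real.sqrt_mul L.p11_nonneg, Real.sqrt_mul L.p10_nonneg]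
    have h1 : √L.p11 ^ 2 + √L.p10 ^ 2 + √L.p01 ^ 2 + √L.p00 ^ 2 = 1 := by
      rw [Real.sq_sqrt L.p11_nonneg, Real.sq_sqrt L.p10_nonneg, Real.sq_sqrt L.p01_nonneg,
        Real.sq_sqrt L.p00_nonneg, L.sum_eq_one]
    linear_combination (1 + √L.p11 ^ 2 + √L.p10 ^ 2 + √L.p01 ^ 2 + √L.p00 ^ 2) * h1
  rw [hsNorm, h, Real.sqrt_le_left (Real.exp_pos _).le, ← Real.exp_nat_mul]
  have := Real.add_one_le_exp (-(2 * L.psi))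
  push_cast
  rw [mul_neg]
  linarith

/-- If `p10` and `p01` are at most of the order of `p11`, then even the tilted overlap matrix has
Hilbert–Schmidt norm `exp (-p11 + O(p11 ^ (3/2)))`. -/
theorem hsNorm_overlap_le (L : PairLaw) {z k : ℝ} (hz : 0 ≤ z) (hk : 0 ≤ k)
    (h10 : √L.p10 ≤ k * √L.p11) (h01 : √L.p01 ≤ k * √L.p11) :
    hsNorm (L.overlap z) ≤ Real.exp (-(L.p11 -
      ((z + k ^ 2) ^ 2 + z ^ 2 * k ^ 2 + 2 * z * k ^ 2 + 3 * k ^ 2 + (1 + k ^ 2) ^ 2) / 2 *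
        √L.p11 ^ 3)) := by
  set D := (z + k ^ 2) ^ 2 + z ^ 2 * k ^ 2 + 2 * z * k ^ 2 + 3 * k ^ 2 + (1 + k ^ 2) ^ 2 with hD
  have h : ∑ y, ∑ y', L.overlap z y y' ^ 2 ≤ 1 - 2 * L.p11 + D * √L.p11 ^ 3 := by
    rw [sum_overlap_sq]
    have h1 : √L.p11 ^ 2 + √L.p10 ^ 2 + √L.p01 ^ 2 + √L.p00 ^ 2 = 1 := by
      rw [Real.sq_sqrt L.p11_nonneg, Real.sq_sqrt L.p10_nonneg, Real.sq_sqrt L.p01_nonneg,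
        Real.sq_sqrt L.p00_nonneg, L.sum_eq_one]
    rw [← Real.sq_sqrt L.p11_nonneg] at *
    simp only [Real.sqrt_sq (Real.sqrt_nonneg _)] at *
    have ha := Real.sqrt_nonneg L.p11
    have hb := Real.sqrt_nonneg L.p10
    have hc := Real.sqrt_nonneg L.p01
    have hd := Real.sqrt_nonneg L.p00
    generalize √L.p11 = a at *
    generalize √L.p10 = b at *
    generalize √L.p01 = c at *
    generalize √L.p00 = d at *
    have ha1 : a ≤ 1 := by nlinarith [sq_nonneg b, sq_nonneg c, sq_nonneg d]
    have hd1 : d ≤ 1 := by nlinarith [sq_nonneg b, sq_nonneg c, sq_nonneg a]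
    have hbd : b ^ 2 + d ^ 2 = 1 - a ^ 2 - c ^ 2 := by linarith
    have ha43 : a ^ 4 ≤ a ^ 3 := pow_le_pow_of_le_one ha ha1 (by norm_num)
    have hc2 : c ^ 2 ≤ k ^ 2 * a ^ 2 := by
      rw [← mul_pow]; exact pow_le_pow_left₀ hc h01 2
    have hb2 : b ^ 2 ≤ k ^ 2 * a ^ 2 := by
      rw [← mul_pow]; exact pow_le_pow_left₀ hb h10 2
    have hd2 : d ^ 2 ≤ 1 := pow_le_one₀ hd hd1
    have hbc : b * c ≤ k ^ 2 * a ^ 2 := by nlinarith [mul_le_mul h10 h01 hc (by positivity)]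
    have e1 : (z * a ^ 2 + c ^ 2) ^ 2 ≤ (z + k ^ 2) ^ 2 * a ^ 3 := by
      calc _ ≤ (z * a ^ 2 + k ^ 2 * a ^ 2) ^ 2 := by gcongr
        _ = (z + k ^ 2) ^ 2 * a ^ 4 := by ring
        _ ≤ _ := by gcongr
    have e2 : (a * b) ^ 2 ≤ k ^ 2 * a ^ 3 := by
      calc _ = a ^ 2 * b ^ 2 := by ring
        _ ≤ a ^ 2 * (k ^ 2 * a ^ 2) := by gcongr
        _ = k ^ 2 * a ^ 4 := by ring
        _ ≤ _ := by gcongr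
    have e3 : a * b * (c * d) ≤ k ^ 2 * a ^ 3 := by
      calc _ = a * (b * c) * d := by ring
        _ ≤ a * (k ^ 2 * a ^ 2) * 1 := by gcongr
        _ = _ := by ring
    have e4 : (a ^ 2 + c ^ 2) ^ 2 ≤ (1 + k ^ 2) ^ 2 * a ^ 3 := by
      calc _ ≤ (a ^ 2 + k ^ 2 * a ^ 2) ^ 2 := by gcongr
        _ = (1 + k ^ 2) ^ 2 * a ^ 4 := by ring
        _ ≤ _ := by gcongr
    have e5 : (c * d) ^ 2 ≤ c ^ 2 := by
      rw [mul_pow]; nlinarith [sq_nonneg c]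
    have e6 : z ^ 2 * (a * b) ^ 2 ≤ z ^ 2 * (k ^ 2 * a ^ 3) := by gcongr
    have e7 : z * (a * b * (c * d)) ≤ z * (k ^ 2 * a ^ 3) := by gcongr
    rw [hbd, hD]
    linarith
  rw [hsNorm, Real.sqrt_le_left (Real.exp_pos _).le, ← Real.exp_nat_mul]
  refine h.trans ?_
  refine le_trans ?_ (Real.add_one_le_exp _)
  push_cast
  linarith

end PairLaw

/-- Bhattacharyya bound for independent pairs with laws `L e`: relabelling the second coordinates
by `f` costs, per site, at most the corresponding factor of `sum_prod_perm_le`. -/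
theorem sum_sqrt_prod_le {E : Type*} [Fintype E] [DecidableEq E] (L : E → PairLaw) (z : E → ℝ)
    (hz : ∀ e, 0 ≤ z e) (f : Equiv.Perm E) :
    ∑ g₁ : E → Bool, ∑ g₂ : E → Bool, (∏ e, if g₁ e && g₂ e then z e else 1) *
        √((∏ e, (L e).prob (g₁ e) (g₂ e)) * ∏ e, (L e).prob (g₁ e) (g₂ (f e))) ≤
      ∏ e, siteFactor f (fun e => (L e).overlap (z e)) e := by
  have h := sum_prod_perm_le f (fun e => (L e).overlap (z e))
    (fun e x y => (L e).overlap_nonneg (hz e) x y)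
  refine le_trans (le_of_eq ?_) h
  rw [Finset.sum_comm]
  refine Fintype.sum_equiv (Equiv.refl _) _ _ fun g₂ => ?_
  simp only [PairLaw.overlap, Equiv.refl_apply]
  rw [Finset.prod_univ_sum, Fintype.piFinset_univ]
  refine Fintype.sum_congr _ _ fun g₁ => ?_
  rw [Finset.prod_mul_distrib, ← Finset.prod_mul_distrib, Real.sqrt_prod _ fun e _ =>
    mul_nonneg ((L e).prob_nonneg _ _) ((L e).prob_nonneg _ _)]
  rfl

theorem sum_prod_eq {E : Type*} [Fintype E] [DecidableEq E] (L : E → PairLaw) (z : E → ℝ) :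
    ∑ g₁ : E → Bool, ∑ g₂ : E → Bool, (∏ e, if g₁ e && g₂ e then z e else 1) *
        ∏ e, (L e).prob (g₁ e) (g₂ e) = ∏ e, (1 + (z e - 1) * (L e).p11) := by
  have h : ∀ e, 1 + (z e - 1) * (L e).p11 =
      ∑ x : Bool, ∑ y : Bool, (if x && y then z e else 1) * (L e).prob x y := by
    intro e
    have := (L e).sum_eq_one
    simp [PairLaw.prob]
    linarith
  simp_rw [h, Finset.prod_univ_sum, Fintype.piFinset_univ, Finset.prod_mul_distrib]

/-! ### The error event of a MAP estimator -/

variable {n m : ℕ}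

theorem permPair_mul (σ τ : Equiv.Perm (Fin n)) (e : VertexPair n m) :
    permPair (σ * τ) e = permPair σ (permPair τ e) := by
  rcases e with e | ⟨i, v⟩
  · simp [permPair, Sym2.map_map]
  · rfl

theorem permPair_one (e : VertexPair n m) : permPair 1 e = e := by
  rcases e with e | ⟨i, v⟩
  · simp [permPair]
  · rfl

/-- The permutation of the vertex pairs induced by a permutation of the users. -/
def pairPerm (m : ℕ) (τ : Equiv.Perm (Fin n)) : Equiv.Perm (VertexPair n m) where
  toFun := permPair τ
  invFun := permPair τ⁻¹
  left_inv e := by rw [← permPair_mul, inv_mul_cancel, permPair_one]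
  right_inv e := by rw [← permPair_mul, mul_inv_cancel, permPair_one]

theorem relabel_mul (σ τ : Equiv.Perm (Fin n)) (g : AttributedGraph n m) :
    relabel (σ * τ) g = relabel σ (relabel τ g) := by
  funext e
  simp [relabel, permPair_mul]

theorem relabel_one (g : AttributedGraph n m) : relabel 1 g = g := by
  funext e
  simp [relabel, permPair_one]

theorem relabel_eq_iff (π : Equiv.Perm (Fin n)) (g h : AttributedGraph n m) :
    relabel π g = h ↔ g = relabel π⁻¹ h := by
  constructor
  · rintro rfl
    rw [← relabel_mul, inv_mul_cancel, relabel_one]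
  · rintro rfl
    rw [← relabel_mul, mul_inv_cancel, relabel_one]

theorem graphPairProb_nonneg (p q : PairLaw) (g₁ g₂ : AttributedGraph n m) :
    0 ≤ graphPairProb p q g₁ g₂ :=
  mul_nonneg (Finset.prod_nonneg fun _ _ => p.prob_nonneg _ _)
    (Finset.prod_nonneg fun _ _ => q.prob_nonneg _ _)

theorem observedProb_eq (p q : PairLaw) (π : Equiv.Perm (Fin n)) (g₁ h : AttributedGraph n m) :
    observedProb p q π g₁ h =
      (Fintype.card (Equiv.Perm (Fin n)) : ℝ)⁻¹ * graphPairProb p q g₁ (relabel π⁻¹ h) := by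
  simp [observedProb, relabel_eq_iff, jointProb]

theorem errorProb_nonneg (p q : PairLaw) (est : Estimator n m) : 0 ≤ errorProb p q est := by
  refine Finset.sum_nonneg fun π _ => Finset.sum_nonneg fun g₁ _ => Finset.sum_nonneg fun g₂ _ => ?_
  split_ifs
  · exact mul_nonneg (by positivity) (graphPairProb_nonneg _ _ _ _)
  · exact le_rfl

open Classical in
/-- A MAP estimator can only fail if some relabelling of `G₂` by a non-trivial permutation is at
least as likely as `G₂` itself. -/
theorem errorProb_le_of_isMAP (p q : PairLaw) (est : Estimator n m) (h : IsMAP p q est) :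
    errorProb p q est ≤ ∑ g₁ : AttributedGraph n m, ∑ g₂ : AttributedGraph n m,
      if ∃ τ : Equiv.Perm (Fin n), τ ≠ 1 ∧
        graphPairProb p q g₁ g₂ ≤ graphPairProb p q g₁ (relabel τ g₂)
      then graphPairProb p q g₁ g₂ else 0 := by
  set X := ∑ g₁ : AttributedGraph n m, ∑ g₂ : AttributedGraph n m,
      if ∃ τ : Equiv.Perm (Fin n), τ ≠ 1 ∧
        graphPairProb p q g₁ g₂ ≤ graphPairProb p q g₁ (relabel τ g₂)
      then graphPairProb p q g₁ g₂ else 0 with hX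
  have hN : (0 : ℝ) < Fintype.card (Equiv.Perm (Fin n)) := by
    exact_mod_cast Fintype.card_pos
  have key : ∀ π : Equiv.Perm (Fin n),
      (∑ g₁ : AttributedGraph n m, ∑ g₂ : AttributedGraph n m,
        if est g₁ (relabel π g₂) ≠ π then jointProb p q π g₁ g₂ else 0) ≤
      (Fintype.card (Equiv.Perm (Fin n)) : ℝ)⁻¹ * X := by
    intro π
    simp_rw [hX, Finset.mul_sum]
    refine Finset.sum_le_sum fun g₁ _ => Finset.sum_le_sum fun g₂ _ => ?_
    split_ifs with h1 h2 h2
    · rfl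
    · rw [mul_zero]
      rcases (graphPairProb_nonneg p q g₁ g₂).eq_or_lt with h0 | h0
      · rw [jointProb, ← h0, mul_zero]
      · refine absurd ?_ h2
        set σ := est g₁ (relabel π g₂) with hσ
        have hpost := h g₁ (relabel π g₂) π
        have hpos : 0 < ∑ σ : Equiv.Perm (Fin n), observedProb p q σ g₁ (relabel π g₂) := by
          refine Finset.sum_pos' (fun σ _ => ?_) ⟨π, Finset.mem_univ _, ?_⟩
          · rw [observedProb_eq]
            exact mul_nonneg (by positivity) (graphPairProb_nonneg _ _ _ _)
          · rw [observedProb_eq, ← relabel_mul, inv_mul_cancel, relabel_one]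
            positivity
        rw [posterior, posterior, div_le_div_iff_of_pos_right hpos, ← hσ, observedProb_eq,
          observedProb_eq, mul_le_mul_iff_right₀ (inv_pos.2 hN), ← relabel_mul, ← relabel_mul,
          inv_mul_cancel, relabel_one] at hpost
        refine ⟨σ⁻¹ * π, fun hc => h1 ?_, hpost⟩
        exact inv_mul_eq_one.1 hc
    · exact mul_nonneg (by positivity) (graphPairProb_nonneg _ _ _ _)
    · rw [mul_zero]
  calc errorProb p q est ≤ ∑ _π : Equiv.Perm (Fin n),
        (Fintype.card (Equiv.Perm (Fin n)) : ℝ)⁻¹ * X := Finset.sum_le_sum fun π _ => key π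
    _ = X := by
      rw [Finset.sum_const, Finset.card_univ, nsmul_eq_mul, mul_inv_cancel_left₀ hN.ne']

theorem exists_isMAP (p q : PairLaw) : ∃ est : Estimator n m, IsMAP p q est := by
  choose est hest using fun (g₁ h : AttributedGraph n m) =>
    Finite.exists_max (posterior p q g₁ h)
  exact ⟨est, hest⟩

open Classical in
/-- The union bound over the wrong permutations, off an exceptional event `bad S` that may depend
on the set `S` of users that are moved. -/
theorem errorProb_le_sum_add_sum (p q : PairLaw) (est : Estimator n m) (h : IsMAP p q est)
    (bad : Finset (Fin n) → AttributedGraph n m → AttributedGraph n m → Prop) :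
    errorProb p q est ≤
      (∑ S, ∑ g₁, ∑ g₂, if bad S g₁ g₂ then graphPairProb p q g₁ g₂ else 0) +
      ∑ τ ∈ Finset.univ.erase (1 : Equiv.Perm (Fin n)), ∑ g₁, ∑ g₂,
        if bad τ.support g₁ g₂ then 0 else
          √(graphPairProb p q g₁ g₂ * graphPairProb p q g₁ (relabel τ g₂)) := by
  refine (errorProb_le_of_isMAP p q est h).trans ?_
  rw [Finset.sum_comm (s := (Finset.univ : Finset (Finset (Fin n)))),
    Finset.sum_comm (s := Finset.univ.erase _), ← Finset.sum_add_distrib]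
  refine Finset.sum_le_sum fun g₁ _ => ?_
  rw [Finset.sum_comm (s := (Finset.univ : Finset (Finset (Fin n)))),
    Finset.sum_comm (s := Finset.univ.erase _), ← Finset.sum_add_distrib]
  refine Finset.sum_le_sum fun g₂ _ => ?_
  have hP := graphPairProb_nonneg p q g₁ g₂
  have h1 : ∀ S, 0 ≤ if bad S g₁ g₂ then graphPairProb p q g₁ g₂ else 0 := by
    intro S; split_ifs <;> [exact hP; exact le_rfl]
  have h2 : ∀ τ : Equiv.Perm (Fin n), 0 ≤ if bad τ.support g₁ g₂ then 0 else
      √(graphPairProb p q g₁ g₂ * graphPairProb p q g₁ (relabel τ g₂)) := by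
    intro τ; split_ifs <;> positivity
  split_ifs with hτ
  · obtain ⟨τ, hτ1, hle⟩ := hτ
    by_cases hb : bad τ.support g₁ g₂
    · have := Finset.single_le_sum (fun S _ => h1 S) (Finset.mem_univ τ.support)
      rw [if_pos hb] at this
      exact this.trans (le_add_of_nonneg_right (Finset.sum_nonneg fun τ _ => h2 τ))
    · have := Finset.single_le_sum (s := Finset.univ.erase 1) (fun τ _ => h2 τ)
        (Finset.mem_erase.2 ⟨hτ1, Finset.mem_univ τ⟩)
      rw [if_neg hb] at this
      refine le_trans (le_trans ?_ this) (le_add_of_nonneg_left (Finset.sum_nonneg fun S _ => h1 S))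
      refine Real.le_sqrt_of_sq_le ?_
      rw [sq]
      exact mul_le_mul_of_nonneg_left hle hP
  · exact add_nonneg (Finset.sum_nonneg fun S _ => h1 S) (Finset.sum_nonneg fun τ _ => h2 τ)

/-! ### Moved vertex pairs and common edges -/

open Classical in
/-- The user pairs with at least one endpoint in `S`. -/
def touching (S : Finset (Fin n)) : Finset (UserPair n) :=
  Finset.univ.filter fun e => ∃ i ∈ S, i ∈ e.1

theorem mem_touching {S : Finset (Fin n)} {e : UserPair n} :
    e ∈ touching S ↔ ∃ i ∈ S, i ∈ e.1 := by
  simp [touching]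

/-- The pairs that do not touch `S` are the pairs inside its complement. -/
theorem card_touching (S : Finset (Fin n)) :
    ((touching S).card : ℝ) = S.card * (2 * n - S.card - 1) / 2 := by
  classical
  have h1 : ((touching S)ᶜ).card = (n - S.card).choose 2 := by
    have := Sym2.card_image_offDiag (Sᶜ)
    rw [Finset.card_compl, Fintype.card_fin] at this
    rw [← this, ← Finset.card_map (Function.Embedding.subtype _)]
    congr 1
    ext e
    induction e using Sym2.ind with
    | _ a b =>
    simp only [Finset.mem_map, Finset.mem_compl, mem_touching, Function.Embedding.subtype_apply,
      Subtype.exists, exists_and_right, exists_eq_right, Sym2.mem_iff, Finset.mem_image,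
      Finset.mem_offDiag, Prod.exists, Sym2.mk_isDiag_iff]
    constructor
    · rintro ⟨h, h'⟩
      exact ⟨a, b, ⟨fun ha => h' ⟨a, ha, Or.inl rfl⟩, fun hb => h' ⟨b, hb, Or.inr rfl⟩, h⟩, rfl⟩
    · rintro ⟨c, d, ⟨hc, hd, hcd⟩, h⟩
      rcases Sym2.eq_iff.1 h with ⟨rfl, rfl⟩ | ⟨rfl, rfl⟩
      · exact ⟨hcd, by rintro ⟨i, hi, rfl | rfl⟩ <;> contradiction⟩
      · exact ⟨Ne.symm hcd, by rintro ⟨i, hi, rfl | rfl⟩ <;> contradiction⟩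
  have h2 := Finset.card_add_card_compl (touching S)
  rw [h1, Sym2.card_subtype_not_diag, Fintype.card_fin] at h2
  have hS : S.card ≤ n := by simpa using S.card_le_univ
  have h3 : ((touching S).card : ℝ) + ((n - S.card).choose 2 : ℕ) = (n.choose 2 : ℕ) := by
    exact_mod_cast h2
  rw [Nat.cast_choose_two, Nat.cast_choose_two, Nat.cast_sub hS] at h3
  linear_combination h3

theorem pairPerm_inl_of_not_mem_touching {τ : Equiv.Perm (Fin n)} {e : UserPair n}
    (h : e ∉ touching τ.support) : pairPerm m τ (Sum.inl e) = Sum.inl e := by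
  obtain ⟨e, he⟩ := e
  induction e using Sym2.ind with
  | _ a b =>
  simp only [mem_touching, Equiv.Perm.mem_support, Sym2.mem_iff, not_exists, not_and] at h
  have ha : τ a = a := by
    by_contra hc; exact h a hc (Or.inl rfl)
  have hb : τ b = b := by
    by_contra hc; exact h b hc (Or.inr rfl)
  simp [pairPerm, permPair, ha, hb]

open Classical in
/-- At most one fixed pair `{i, τ i}` arises from each moved user `i`. -/
theorem card_fixed_touching_le (τ : Equiv.Perm (Fin n)) :
    ((touching τ.support).filter
      fun e => pairPerm m τ (Sum.inl e) = Sum.inl e).card ≤ τ.support.card := by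
  rw [← Finset.card_map (Function.Embedding.subtype _)]
  refine le_trans (Finset.card_le_card ?_)
    (Finset.card_image_le (s := τ.support) (f := fun i => s(i, τ i)))
  intro e he
  simp only [Finset.mem_map, Finset.mem_filter, mem_touching, Function.Embedding.subtype_apply,
    Subtype.exists, exists_and_right, exists_eq_right] at he
  obtain ⟨hd, ⟨i, hi, hie⟩, hfix⟩ := he
  refine Finset.mem_image.2 ⟨i, hi, ?_⟩
  obtain ⟨j, rfl⟩ := Sym2.mem_iff_exists.1 hie
  simp only [pairPerm, permPair, Equiv.coe_fn_mk, Sum.inl.injEq, Subtype.mk.injEq, Sym2.map_mk]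
    at hfix
  rcases Sym2.eq_iff.1 hfix with ⟨h1, -⟩ | ⟨h1, -⟩
  · exact absurd h1 (Equiv.Perm.mem_support.1 hi)
  · rw [h1]

/-- The number of common edges of two graphs among the user pairs touching `S`. -/
def commonEdges (S : Finset (Fin n)) (g₁ g₂ : AttributedGraph n m) : ℕ :=
  ((touching S).filter fun e => g₁ (Sum.inl e) && g₂ (Sum.inl e)).card

/-- The law of the edge indicators at a vertex pair. -/
def pairLaw (m : ℕ) (p q : PairLaw) : VertexPair n m → PairLaw :=
  Sum.elim (fun _ => p) fun _ => q

open Classical in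
/-- The weight `z` on user pairs touching `S`, and `1` on all other pairs. -/
def touchWeight (m : ℕ) (S : Finset (Fin n)) (z : ℝ) : VertexPair n m → ℝ :=
  Sum.elim (fun e => if e ∈ touching S then z else 1) fun _ => 1

theorem graphPairProb_eq_prod (p q : PairLaw) (g₁ g₂ : AttributedGraph n m) :
    graphPairProb p q g₁ g₂ = ∏ e, (pairLaw m p q e).prob (g₁ e) (g₂ e) := by
  rw [Fintype.prod_sum_type]
  rfl

theorem prod_touchWeight (S : Finset (Fin n)) (z : ℝ) (g₁ g₂ : AttributedGraph n m) :
    (∏ e, if g₁ e && g₂ e then touchWeight m S z e else 1) = z ^ commonEdges S g₁ g₂ := by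
  classical
  rw [Fintype.prod_sum_type]
  simp only [touchWeight, Sum.elim_inl, Sum.elim_inr, ite_self, Finset.prod_const_one, mul_one]
  rw [commonEdges, ← Finset.prod_const, Finset.prod_filter, ← Finset.prod_subset
    (Finset.subset_univ (touching S))]
  · exact Finset.prod_congr rfl fun e he => by simp [he]
  · intro e _ he
    simp [he]

/-- The moment generating function of the number of common edges touching `S`. -/
theorem sum_pow_commonEdges (p q : PairLaw) (S : Finset (Fin n)) (z : ℝ) :
    ∑ g₁ : AttributedGraph n m, ∑ g₂ : AttributedGraph n m,
      z ^ commonEdges S g₁ g₂ * graphPairProb p q g₁ g₂ =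
        (1 + (z - 1) * p.p11) ^ (touching S).card := by
  classical
  simp_rw [← prod_touchWeight, graphPairProb_eq_prod, sum_prod_eq]
  rw [Fintype.prod_sum_type]
  simp only [touchWeight, pairLaw, Sum.elim_inl, Sum.elim_inr, sub_self, zero_mul, add_zero,
    Finset.prod_const_one, mul_one]
  rw [← Finset.prod_const, ← Finset.prod_subset (Finset.subset_univ (touching S))]
  · exact Finset.prod_congr rfl fun e he => by simp [he]
  · intro e _ he
    simp [he]

/-- The tilted Bhattacharyya overlap between the true and a relabelled second graph. -/
theorem sum_pow_commonEdges_sqrt_le (p q : PairLaw) (τ : Equiv.Perm (Fin n)) {z α β : ℝ}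
    (hz : 1 ≤ z) (hα : 0 ≤ α) (hβ : 0 ≤ β)
    (hp : hsNorm (p.overlap z) ≤ Real.exp (-(α - β))) :
    ∑ g₁ : AttributedGraph n m, ∑ g₂ : AttributedGraph n m,
      z ^ commonEdges τ.support g₁ g₂ *
        √(graphPairProb p q g₁ g₂ * graphPairProb p q g₁ (relabel τ g₂)) ≤
      Real.exp (-(α - β) * (touching τ.support).card +
        (α + (z - 1) * p.p11) * τ.support.card - m * q.psi * τ.support.card) := by
  classical
  set f := pairPerm m τ⁻¹ with hf
  have hrel : ∀ g₁ g₂ : AttributedGraph n m, graphPairProb p q g₁ (relabel τ g₂) =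
      ∏ e, (pairLaw m p q e).prob (g₁ e) (g₂ (f e)) := fun g₁ g₂ => graphPairProb_eq_prod _ _ _ _
  have hw : ∀ e, 0 ≤ touchWeight m τ.support z e := by
    rintro (e | e)
    · simp only [touchWeight, Sum.elim_inl]
      split_ifs <;> linarith
    · simp [touchWeight]
  have h := sum_sqrt_prod_le (pairLaw m p q) (touchWeight m τ.support z) hw f
  simp_rw [← prod_touchWeight, hrel, graphPairProb_eq_prod]
  refine h.trans ?_
  have hsf0 : ∀ e, 0 ≤ siteFactor f
      (fun e => (pairLaw m p q e).overlap (touchWeight m τ.support z e)) e :=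
    fun e => siteFactor_nonneg _ (fun e x y => PairLaw.overlap_nonneg _ (hw e) x y) e
  rw [Fintype.prod_sum_type]
  have hattr : ∏ e : AttrPair n m, siteFactor f
      (fun e => (pairLaw m p q e).overlap (touchWeight m τ.support z e)) (Sum.inr e) ≤
      Real.exp (-(m * q.psi * τ.support.card)) := by
    obtain ⟨u, hu⟩ : ∃ u : Fin n → ℝ, ∀ i, u i = if i ∈ τ.support then -q.psi else 0 :=
      ⟨_, fun _ => rfl⟩
    have h1 : ∀ e : AttrPair n m, siteFactor f
        (fun e => (pairLaw m p q e).overlap (touchWeight m τ.support z e)) (Sum.inr e) ≤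
        Real.exp (u e.1) := by
      rintro ⟨i, v⟩
      by_cases hi : i ∈ τ.support
      · have hne : f (Sum.inr (i, v)) ≠ Sum.inr (i, v) := by
          rw [← Equiv.Perm.support_inv, Equiv.Perm.mem_support] at hi
          simpa [f, pairPerm, permPair] using hi
        rw [siteFactor_of_ne hne, hu, if_pos hi]
        simpa [pairLaw, touchWeight] using q.hsNorm_overlap_one_le
      · have heq : f (Sum.inr (i, v)) = Sum.inr (i, v) := by
          rw [← Equiv.Perm.support_inv, Equiv.Perm.mem_support, not_not] at hi
          simpa [f, pairPerm, permPair] using hi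
        rw [siteFactor_of_eq heq, hu, if_neg hi]
        simp only [pairLaw, touchWeight, Sum.elim_inr, PairLaw.sum_overlap_self]
        simp
    refine (Finset.prod_le_prod (fun e _ => hsf0 _) fun e _ => h1 e).trans (le_of_eq ?_)
    rw [← Real.exp_sum, Fintype.sum_prod_type]
    simp only [Finset.sum_const, Finset.card_univ, Fintype.card_fin, nsmul_eq_mul]
    simp_rw [← Finset.mul_sum, hu]
    rw [Finset.sum_ite_mem, Finset.univ_inter, Finset.sum_const, nsmul_eq_mul]
    congr 1
    ring
  set F := (touching τ.support).filter fun e => pairPerm m τ⁻¹ (Sum.inl e) = Sum.inl e with hF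
  have hFcard : (F.card : ℝ) ≤ τ.support.card := by
    have := card_fixed_touching_le (m := m) τ⁻¹
    rw [Equiv.Perm.support_inv] at this
    exact_mod_cast this
  have huser : ∏ e : UserPair n, siteFactor f
      (fun e => (pairLaw m p q e).overlap (touchWeight m τ.support z e)) (Sum.inl e) ≤
      Real.exp (-(α - β) * (touching τ.support).card +
        (α + (z - 1) * p.p11) * τ.support.card) := by
    have h1 : ∀ e : UserPair n, siteFactor f
        (fun e => (pairLaw m p q e).overlap (touchWeight m τ.support z e)) (Sum.inl e) ≤
        Real.exp ((if e ∈ touching τ.support then -(α - β) else 0) +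
          if e ∈ F then α + (z - 1) * p.p11 else 0) := by
      intro e
      by_cases he : f (Sum.inl e) = Sum.inl e
      · rw [siteFactor_of_eq he]
        by_cases ht : e ∈ touching τ.support
        · rw [if_pos ht, if_pos (Finset.mem_filter.2 ⟨ht, he⟩)]
          simp only [pairLaw, touchWeight, Sum.elim_inl, PairLaw.sum_overlap_self, if_pos ht]
          refine le_trans ?_ (Real.add_one_le_exp _)
          linarith
        · rw [if_neg ht, if_neg (fun h : e ∈ F => ht (Finset.mem_filter.1 h).1)]
          simp only [pairLaw, touchWeight, Sum.elim_inl, if_neg ht, PairLaw.sum_overlap_self]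
          simp
      · have ht : e ∈ touching τ.support := by
          by_contra hc
          rw [← Equiv.Perm.support_inv] at hc
          exact he (pairPerm_inl_of_not_mem_touching hc)
        rw [siteFactor_of_ne he, if_pos ht, if_neg (fun h : e ∈ F => he (Finset.mem_filter.1 h).2),
          add_zero]
        simpa [pairLaw, touchWeight, ht] using hp
    refine (Finset.prod_le_prod (fun e _ => hsf0 _) fun e _ => h1 e).trans ?_
    rw [← Real.exp_sum, Real.exp_le_exp, Finset.sum_add_distrib, Finset.sum_ite_mem,
      Finset.sum_ite_mem, Finset.univ_inter, Finset.univ_inter, Finset.sum_const,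
      Finset.sum_const, nsmul_eq_mul, nsmul_eq_mul]
    have : 0 ≤ α + (z - 1) * p.p11 :=
      add_nonneg hα (mul_nonneg (by linarith) p.p11_nonneg)
    nlinarith
  refine (mul_le_mul huser hattr (Finset.prod_nonneg fun e _ => hsf0 _)
    (Real.exp_pos _).le).trans (le_of_eq ?_)
  rw [← Real.exp_add, ← sub_eq_add_neg]

/-! ### Union bounds -/

theorem card_support_eq_le (S : Finset (Fin n)) :
    (Finset.univ.filter fun τ : Equiv.Perm (Fin n) => τ.support = S).card ≤ S.card.factorial := by
  have h := Fintype.card_congr (Equiv.Perm.subtypeEquivSubtypePerm (fun i => i ∈ S))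
  rw [Fintype.card_perm, Fintype.card_coe] at h
  rw [h, Fintype.card_subtype]
  refine Finset.card_le_card fun τ hτ => ?_
  rw [Finset.mem_filter] at hτ ⊢
  refine ⟨hτ.1, fun a ha => ?_⟩
  rwa [← hτ.2, Equiv.Perm.mem_support, not_not] at ha

theorem sum_pow_succ_le {x : ℝ} (h0 : 0 ≤ x) (h1 : x ≤ 1 / 2) (N : ℕ) :
    ∑ k ∈ Finset.range N, x ^ (k + 1) ≤ 2 * x := by
  have h2 : ∑ k ∈ Finset.range N, x ^ k ≤ (1 - x)⁻¹ := by
    rw [← tsum_geometric_of_lt_one h0 (by linarith)]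
    exact (summable_geometric_of_lt_one h0 (by linarith)).sum_le_tsum _ fun k _ => by positivity
  have h3 : (1 - x)⁻¹ ≤ 2 := by
    rw [inv_le_comm₀ (by linarith) (by norm_num)]
    linarith
  simp_rw [pow_succ]
  rw [← Finset.sum_mul]
  exact mul_le_mul_of_nonneg_right (h2.trans h3) h0

theorem sum_finset_card (u : ℕ → ℝ) (h0 : u 0 = 0) :
    ∑ S : Finset (Fin n), u S.card =
      ∑ k ∈ Finset.range n, (n.choose (k + 1) : ℝ) * u (k + 1) := by
  rw [← Finset.powerset_univ, Finset.sum_powerset_apply_card, Finset.card_univ, Fintype.card_fin,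
    Finset.sum_range_succ', h0]
  simp

/-- At most `n.choose k * k ! ≤ n ^ k` permutations move exactly `k` of the `n` users. -/
theorem sum_pow_card_support_le {r : ℝ} (h0 : 0 ≤ r) (h1 : n * r ≤ 1 / 2) :
    ∑ τ ∈ Finset.univ.erase (1 : Equiv.Perm (Fin n)), r ^ τ.support.card ≤ 2 * (n * r) := by
  obtain ⟨u, hu⟩ : ∃ u : ℕ → ℝ, ∀ k, u k = if k = 0 then 0 else r ^ k := ⟨_, fun _ => rfl⟩
  have hu0 : ∀ k, 0 ≤ u k := fun k => by rw [hu]; split_ifs <;> positivity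
  calc ∑ τ ∈ Finset.univ.erase (1 : Equiv.Perm (Fin n)), r ^ τ.support.card
      ≤ ∑ τ ∈ Finset.univ.erase (1 : Equiv.Perm (Fin n)), u τ.support.card := by
        refine Finset.sum_le_sum fun τ hτ => ?_
        rw [hu, if_neg]
        rw [Equiv.Perm.card_support_eq_zero]
        exact Finset.ne_of_mem_erase hτ
    _ ≤ ∑ τ : Equiv.Perm (Fin n), u τ.support.card :=
        Finset.sum_le_sum_of_subset_of_nonneg (Finset.erase_subset _ _) fun _ _ _ => hu0 _
    _ = ∑ S : Finset (Fin n), ∑ τ : Equiv.Perm (Fin n) with τ.support = S, u τ.support.card :=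
        (Finset.sum_fiberwise _ _ _).symm
    _ ≤ ∑ S : Finset (Fin n), S.card.factorial * u S.card := by
        refine Finset.sum_le_sum fun S _ => ?_
        rw [Finset.sum_congr rfl (g := fun _ => u S.card)
          fun τ hτ => by rw [(Finset.mem_filter.1 hτ).2], Finset.sum_const, nsmul_eq_mul]
        exact mul_le_mul_of_nonneg_right (by exact_mod_cast card_support_eq_le S) (hu0 _)
    _ = ∑ k ∈ Finset.range n, (n.choose (k + 1) : ℝ) * ((k + 1).factorial * u (k + 1)) :=
        sum_finset_card (fun k => k.factorial * u k) (by simp [hu])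
    _ ≤ ∑ k ∈ Finset.range n, (n * r) ^ (k + 1) := by
        refine Finset.sum_le_sum fun k _ => ?_
        rw [hu, if_neg (by omega), mul_pow, ← mul_assoc]
        refine mul_le_mul_of_nonneg_right ?_ (by positivity)
        have := Nat.descFactorial_le_pow n (k + 1)
        rw [Nat.descFactorial_eq_factorial_mul_choose, mul_comm] at this
        exact_mod_cast this
    _ ≤ _ := sum_pow_succ_le (by positivity) h1 n

theorem choose_le_exp_mul_pow {k : ℕ} (hk : 0 < k) :
    (n.choose k : ℝ) ≤ (Real.exp 1 * (n / k)) ^ k := by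
  have hk' : (0 : ℝ) < k := by exact_mod_cast hk
  refine (Nat.choose_le_pow_div k n).trans ?_
  have h := Real.pow_div_factorial_le_exp (k : ℝ) hk'.le k
  rw [mul_pow, ← Real.exp_nat_mul, mul_one, div_pow]
  calc (n : ℝ) ^ k / k.factorial = (k : ℝ) ^ k / k.factorial * ((n : ℝ) ^ k / (k : ℝ) ^ k) := by
        field_simp
    _ ≤ _ := by gcongr

/-- Union bound over the sets `S` with `s < |S| p`: there are at most `(e n / k) ^ k` of size `k`,
and `n / k < n p / s`, whereas each has probability at most `exp (-n p / 16) ^ k`. -/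
theorem sum_exp_card_touching_le {p s : ℝ} (hp : 0 ≤ p) (hs : 32 ≤ s) (hn : 2 ≤ n) :
    ∑ S : Finset (Fin n), (if s < S.card * p then
      Real.exp (-(p * (touching S).card / 4)) else 0) ≤ 32 / s := by
  have hn' : (2 : ℝ) ≤ n := by exact_mod_cast hn
  obtain ⟨u, hu⟩ : ∃ u : ℕ → ℝ, ∀ k : ℕ, u k =
    if s < k * p then Real.exp (-(p * n / 16)) ^ k else 0 := ⟨_, fun _ => rfl⟩
  calc _ ≤ ∑ S : Finset (Fin n), u S.card := by
        refine Finset.sum_le_sum fun S _ => ?_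
        rw [hu]
        split_ifs with h
        · rw [← Real.exp_nat_mul, Real.exp_le_exp, card_touching]
          have hS : (S.card : ℝ) ≤ n := by
            have : S.card ≤ n := by simpa using S.card_le_univ
            exact_mod_cast this
          have h0 : 0 ≤ p * S.card := by positivity
          nlinarith
        · rfl
    _ = ∑ k ∈ Finset.range n, (n.choose (k + 1) : ℝ) * u (k + 1) := by
        refine sum_finset_card u ?_
        rw [hu, if_neg]
        simp only [Nat.cast_zero, zero_mul]
        linarith
    _ ≤ ∑ k ∈ Finset.range n, (16 / s) ^ (k + 1) := by
        refine Finset.sum_le_sum fun k _ => ?_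
        rw [hu]
        split_ifs with h
        · refine (mul_le_mul_of_nonneg_right (choose_le_exp_mul_pow k.succ_pos)
            (by positivity)).trans ?_
          rw [← mul_pow]
          refine pow_le_pow_left₀ (by positivity) ?_ _
          have hk : (0 : ℝ) < ((k + 1 : ℕ) : ℝ) := by positivity
          have h1 : (n : ℝ) / ((k + 1 : ℕ) : ℝ) ≤ n * p / s := by
            rw [div_le_div_iff₀ hk (by linarith)]
            nlinarith
          have h2 : Real.exp 1 * (p * n / 16) * Real.exp (-(p * n / 16)) ≤ 1 := by
            have := Real.add_one_le_exp (p * n / 16 - 1)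
            have h3 : Real.exp 1 * Real.exp (p * n / 16 - 1) * Real.exp (-(p * n / 16)) = 1 := by
              rw [← Real.exp_add, ← Real.exp_add, ← Real.exp_zero]
              congr 1
              ring
            refine le_trans ?_ h3.le
            exact mul_le_mul_of_nonneg_right (mul_le_mul_of_nonneg_left (by linarith)
              (Real.exp_pos _).le) (Real.exp_pos _).le
          calc _ ≤ Real.exp 1 * (n * p / s) * Real.exp (-(p * n / 16)) := by gcongr
            _ = 16 / s * (Real.exp 1 * (p * n / 16) * Real.exp (-(p * n / 16))) := by ring
            _ ≤ 16 / s * 1 := by gcongr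
            _ = _ := mul_one _
        · rw [mul_zero]
          positivity
    _ ≤ 2 * (16 / s) := by
        refine sum_pow_succ_le (by positivity) ?_ n
        rw [div_le_div_iff₀ (by linarith) (by norm_num)]
        linarith
    _ = _ := by ring

open Classical in
/-- Chernoff bound for the lower tail of the number of common edges touching `S`. -/
theorem sum_few_commonEdges_le (p q : PairLaw) (S : Finset (Fin n)) :
    ∑ g₁ : AttributedGraph n m, ∑ g₂ : AttributedGraph n m,
      (if (commonEdges S g₁ g₂ : ℝ) < p.p11 * (touching S).card / 4 then
        graphPairProb p q g₁ g₂ else 0) ≤ Real.exp (-(p.p11 * (touching S).card / 4)) := by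
  set N : ℝ := ((touching S).card : ℝ) with hN
  have h1 := sum_pow_commonEdges (m := m) p q S (Real.exp (-1))
  calc _ ≤ ∑ g₁ : AttributedGraph n m, ∑ g₂ : AttributedGraph n m,
        Real.exp (p.p11 * N / 4) *
          (Real.exp (-1) ^ commonEdges S g₁ g₂ * graphPairProb p q g₁ g₂) := by
        refine Finset.sum_le_sum fun g₁ _ => Finset.sum_le_sum fun g₂ _ => ?_
        have hP := graphPairProb_nonneg p q g₁ g₂
        split_ifs with h
        · rw [← mul_assoc, ← Real.exp_nat_mul, ← Real.exp_add]
          refine le_mul_of_one_le_left hP (Real.one_le_exp ?_)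
          linarith
        · positivity
    _ = Real.exp (p.p11 * N / 4) * (1 + (Real.exp (-1) - 1) * p.p11) ^ (touching S).card := by
        rw [← h1]
        simp_rw [Finset.mul_sum]
    _ ≤ Real.exp (p.p11 * N / 4) * Real.exp (-(p.p11 / 2)) ^ (touching S).card := by
        have h2 : Real.exp (-1) ≤ 1 / 2 := by
          rw [Real.exp_neg, inv_le_comm₀ (Real.exp_pos _) (by norm_num)]
          linarith [Real.add_one_le_exp 1]
        have h3 := p.p11_nonneg
        have h4 : p.p11 ≤ 1 := by
          linarith [p.p10_nonneg, p.p01_nonneg, p.p00_nonneg, p.sum_eq_one]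
        have h5 := Real.exp_pos (-1)
        gcongr
        · nlinarith
        · nlinarith [Real.add_one_le_exp (-(p.p11 / 2))]
    _ = _ := by
        rw [← Real.exp_nat_mul, ← Real.exp_add, ← hN]
        congr 1
        ring

/-- If the user overlap alone beats the entropy of the permutations, with a factor of two to
spare, then the plain union bound suffices. -/
theorem errorProb_le_of_dense (p q : PairLaw) (est : Estimator n m) (h : IsMAP p q est)
    (hn : 4 ≤ n) (hpsi : 2 * Real.log n ≤ p.psi * ((n - 3) / 2)) :
    errorProb p q est ≤ 2 / n := by
  have hn' : (4 : ℝ) ≤ n := by exact_mod_cast hn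
  refine (errorProb_le_sum_add_sum p q est h fun _ _ _ => False).trans ?_
  simp only [if_false, Finset.sum_const_zero, zero_add]
  have hψ : 0 ≤ p.psi := sq_nonneg _
  have hψq : 0 ≤ q.psi := sq_nonneg _
  have hr : (n : ℝ) * Real.exp (-(2 * Real.log n)) = 1 / n := by
    rw [Real.exp_neg, two_mul, Real.exp_add, Real.exp_log (by linarith)]
    field_simp
  calc _ ≤ ∑ τ ∈ Finset.univ.erase (1 : Equiv.Perm (Fin n)),
        Real.exp (-(2 * Real.log n)) ^ τ.support.card := by
        refine Finset.sum_le_sum fun τ _ => ?_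
        have h1 := sum_pow_commonEdges_sqrt_le (m := m) p q τ le_rfl hψ le_rfl
          (by simpa using p.hsNorm_overlap_one_le)
        simp only [one_pow, one_mul] at h1
        refine h1.trans ?_
        rw [← Real.exp_nat_mul, Real.exp_le_exp, card_touching]
        have hS : (τ.support.card : ℝ) ≤ n := by
          have : τ.support.card ≤ n := by simpa using τ.support.card_le_univ
          exact_mod_cast this
        have hk : (0 : ℝ) ≤ τ.support.card := by positivity
        generalize (τ.support.card : ℝ) = k at *
        have e1 : 0 ≤ m * q.psi * k := by positivity
        have e2 : 0 ≤ p.psi * k * (n - k) := mul_nonneg (by positivity) (by linarith)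
        have e3 := mul_le_mul_of_nonneg_left hpsi hk
        linarith
    _ ≤ 2 * (n * Real.exp (-(2 * Real.log n))) := by
        refine sum_pow_card_support_le (Real.exp_pos _).le ?_
        rw [hr, div_le_div_iff₀ (by linarith) (by norm_num)]
        linarith
    _ = _ := by rw [hr]; ring

/-- In the sparse regime, permutations moving few users are handled by the plain Bhattacharyya
bound. For those moving many users this bound loses a factor of up to two in the exponent, and it
is applied after truncating to the event that the moved users have their typical number of common
edges. -/
theorem errorProb_le_of_sparse (p q : PairLaw) (est : Estimator n m) (h : IsMAP p q est)
    (hn : 2 ≤ n) {s β : ℝ} (hs : 32 ≤ s) (hβ : 0 ≤ β)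
    (hlim : s ≤ n * p.p11 + m * q.psi - Real.log n)
    (hp1 : hsNorm (p.overlap 1) ≤ Real.exp (-(p.p11 - β)))
    (hp4 : hsNorm (p.overlap (Real.exp 4)) ≤ Real.exp (-(p.p11 - β)))
    (hsmall : n * β + (Real.exp 4 + 1) * p.p11 ≤ 1) :
    errorProb p q est ≤ 32 / s + 2 * Real.exp (1 - s / 2) := by
  classical
  have hn' : (2 : ℝ) ≤ n := by exact_mod_cast hn
  have hp := p.p11_nonneg
  have hψq : 0 ≤ q.psi := sq_nonneg _
  have he4 : 1 ≤ Real.exp 4 := Real.one_le_exp (by norm_num)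
  refine (errorProb_le_sum_add_sum p q est h fun S g₁ g₂ => s < S.card * p.p11 ∧
    (commonEdges S g₁ g₂ : ℝ) < p.p11 * (touching S).card / 4).trans (add_le_add ?_ ?_)
  · refine le_trans (Finset.sum_le_sum fun S _ => ?_) (sum_exp_card_touching_le hp hs hn)
    by_cases hS : s < S.card * p.p11
    · simp only [hS, true_and, if_true]
      exact sum_few_commonEdges_le p q S
    · simp [hS]
  · have hr : (n : ℝ) * Real.exp (-(Real.log n + s / 2 - 1)) = Real.exp (1 - s / 2) := by
      rw [show -(Real.log n + s / 2 - 1) = -Real.log n + (1 - s / 2) by ring, Real.exp_add,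
        Real.exp_neg, Real.exp_log (by linarith), mul_inv_cancel_left₀ (by linarith)]
    rw [← hr]
    refine le_trans (Finset.sum_le_sum fun τ _ => ?_)
      (sum_pow_card_support_le (Real.exp_pos _).le ?_)
    · have hN := card_touching τ.support
      have hS : (τ.support.card : ℝ) ≤ n := by
        have : τ.support.card ≤ n := by simpa using τ.support.card_le_univ
        exact_mod_cast this
      have hk : (0 : ℝ) ≤ τ.support.card := by positivity
      rw [← Real.exp_nat_mul]
      by_cases hbig : s < τ.support.card * p.p11
      · have h4 := sum_pow_commonEdges_sqrt_le (m := m) p q τ he4 hp hβ hp4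
        set N : ℝ := ((touching τ.support).card : ℝ) with hNdef
        simp only [hbig, true_and]
        -- Off the exceptional event, `exp (4 * commonEdges) ≥ exp (p11 * N)`.
        calc _ ≤ ∑ g₁, ∑ g₂, Real.exp (-(p.p11 * N)) * (Real.exp 4 ^ commonEdges τ.support g₁ g₂ *
              √(graphPairProb p q g₁ g₂ * graphPairProb p q g₁ (relabel τ g₂))) := by
              refine Finset.sum_le_sum fun g₁ _ => Finset.sum_le_sum fun g₂ _ => ?_
              split_ifs with hb
              · positivity
              · rw [← mul_assoc, ← Real.exp_nat_mul, ← Real.exp_add]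
                refine le_mul_of_one_le_left (Real.sqrt_nonneg _) (Real.one_le_exp ?_)
                linarith
          _ = Real.exp (-(p.p11 * N)) * ∑ g₁, ∑ g₂, (Real.exp 4 ^ commonEdges τ.support g₁ g₂ *
              √(graphPairProb p q g₁ g₂ * graphPairProb p q g₁ (relabel τ g₂))) := by
              simp_rw [Finset.mul_sum]
          _ ≤ _ := mul_le_mul_of_nonneg_left h4 (Real.exp_pos _).le
          _ ≤ _ := by
              rw [← Real.exp_add, Real.exp_le_exp, hN]
              generalize (τ.support.card : ℝ) = k at *
              have e1 := mul_le_mul_of_nonneg_left hsmall hk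
              have e2 := mul_le_mul_of_nonneg_left hlim hk
              have e3 : 0 ≤ β * (k * (k + 1)) := by positivity
              have e4 : 0 ≤ p.p11 * (k * (n - k)) :=
                mul_nonneg hp (mul_nonneg hk (by linarith))
              have e5 : 0 ≤ k * s := mul_nonneg hk (by linarith)
              linarith
      · have h1 := sum_pow_commonEdges_sqrt_le (m := m) p q τ le_rfl hp hβ hp1
        simp only [hbig, false_and, if_false]
        simp only [one_pow, one_mul] at h1
        refine h1.trans ?_
        rw [Real.exp_le_exp, hN]
        generalize (τ.support.card : ℝ) = k at *
        have e1 := mul_le_mul_of_nonneg_left hsmall hk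
        have e2 := mul_le_mul_of_nonneg_left hlim hk
        have e3 : 0 ≤ β * (k * (k + 1)) := by positivity
        have e4 := mul_le_mul_of_nonneg_left (not_lt.1 hbig) hk
        have e5 : p.p11 * k ≤ Real.exp 4 * (p.p11 * k) :=
          le_mul_of_one_le_left (by positivity) he4
        have e6 : 0 ≤ p.p11 * k := by positivity
        linarith
    · rw [hr, show (1 : ℝ) - s / 2 = -(s / 2 - 1) by ring, Real.exp_neg,
        inv_le_comm₀ (Real.exp_pos _) (by norm_num)]
      linarith [Real.add_one_le_exp (s / 2 - 1)]

/-! ### Consequences of the correlation bounds -/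

namespace PairLaw

theorem mul_sub_mul_eq_cov (L : PairLaw) : L.p11 * L.p00 - L.p10 * L.p01 = L.cov := by
  have h : L.p00 = 1 - L.p11 - L.p10 - L.p01 := by linarith [L.sum_eq_one]
  rw [cov, mean₁, mean₂, h]
  ring

/-- A correlation bounded below forces a covariance of the order of the edge densities. -/
theorem mul_sqrt_le_cov (L : PairLaw) {c : ℝ} (hc : 0 < c) (h₁ : c ≤ 1 - (L.p11 + L.p10))
    (h₂ : c ≤ 1 - (L.p11 + L.p01)) (hρ : c ≤ L.corr) :
    c ^ 2 * √(L.mean₁ * L.mean₂) ≤ L.cov := by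
  have hm1 : 0 ≤ L.mean₁ := add_nonneg L.p11_nonneg L.p10_nonneg
  have hm2 : 0 ≤ L.mean₂ := add_nonneg L.p11_nonneg L.p01_nonneg
  have hv1 : c * L.mean₁ ≤ L.var₁ := by
    rw [var₁]; unfold mean₁ at *; nlinarith
  have hv2 : c * L.mean₂ ≤ L.var₂ := by
    rw [var₂]; unfold mean₂ at *; nlinarith
  have hcov : L.cov = L.corr * (√L.var₁ * √L.var₂) := by
    rw [corr, div_mul_cancel₀]
    intro h0
    rw [corr, h0, div_zero] at hρ
    linarith
  have hsq : c * √(L.mean₁ * L.mean₂) ≤ √L.var₁ * √L.var₂ := by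
    rw [← Real.sqrt_mul ((mul_nonneg hc.le hm1).trans hv1)]
    refine Real.le_sqrt_of_sq_le ?_
    rw [mul_pow, Real.sq_sqrt (mul_nonneg hm1 hm2)]
    calc c ^ 2 * (L.mean₁ * L.mean₂) = c * L.mean₁ * (c * L.mean₂) := by ring
      _ ≤ _ := mul_le_mul hv1 hv2 (mul_nonneg hc.le hm2) ((mul_nonneg hc.le hm1).trans hv1)
  rw [hcov, sq, mul_assoc]
  exact mul_le_mul hρ hsq (mul_nonneg hc.le (Real.sqrt_nonneg _)) (hc.le.trans hρ)

theorem p11_le_sqrt (L : PairLaw) : L.p11 ≤ √(L.mean₁ * L.mean₂) := by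
  refine Real.le_sqrt_of_sq_le ?_
  rw [sq]
  have h := L.p11_nonneg
  exact mul_le_mul (le_add_of_nonneg_right L.p10_nonneg) (le_add_of_nonneg_right L.p01_nonneg) h
    (add_nonneg h L.p10_nonneg)

theorem p11_pos_of_cov_pos (L : PairLaw) (h : 0 < L.cov) : 0 < L.p11 := by
  have : 0 ≤ L.mean₁ * L.mean₂ := mul_nonneg (add_nonneg L.p11_nonneg L.p10_nonneg)
    (add_nonneg L.p11_nonneg L.p01_nonneg)
  unfold cov at h
  linarith

/-- Since `p11` dominates the covariance, `p10` and `p01` are at most of the order of `p11`. -/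
theorem sqrt_le_of_mul_sqrt_le_cov (L : PairLaw) {κ : ℝ} (hκ : 0 < κ) (hcov : 0 < L.cov)
    (h : κ * √(L.mean₁ * L.mean₂) ≤ L.cov) :
    √L.p10 ≤ κ⁻¹ * √L.p11 ∧ √L.p01 ≤ κ⁻¹ * √L.p11 := by
  have hp := L.p11_pos_of_cov_pos hcov
  have h10 := L.p10_nonneg
  have h01 := L.p01_nonneg
  have hmm : 0 ≤ L.mean₁ * L.mean₂ := mul_nonneg (by unfold mean₁; linarith)
    (by unfold mean₂; linarith)
  have h1 : κ * √(L.mean₁ * L.mean₂) ≤ L.p11 := by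
    refine h.trans ?_
    unfold cov
    linarith
  have h2 : κ ^ 2 * (L.mean₁ * L.mean₂) ≤ L.p11 * L.p11 := by
    have := pow_le_pow_left₀ (by positivity) h1 2
    rwa [mul_pow, Real.sq_sqrt hmm, sq L.p11] at this
  have h3 : ∀ x, κ ^ 2 * x ≤ L.p11 → √x ≤ κ⁻¹ * √L.p11 := by
    intro x hx
    rw [← div_eq_inv_mul, le_div_iff₀ hκ, mul_comm]
    refine Real.le_sqrt_of_sq_le ?_
    rcases le_total 0 x with hx0 | hx0
    · rwa [mul_pow, Real.sq_sqrt hx0]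
    · rw [Real.sqrt_eq_zero_of_nonpos hx0]
      simpa using hp.le
  have hκ2 : 0 < κ ^ 2 := by positivity
  refine ⟨h3 _ (le_of_mul_le_mul_right (h2.trans' ?_) hp),
    h3 _ (le_of_mul_le_mul_right (h2.trans' ?_) hp)⟩
  · rw [mul_assoc]
    refine mul_le_mul_of_nonneg_left ?_ hκ2.le
    unfold mean₁ mean₂
    nlinarith
  · rw [mul_assoc]
    refine mul_le_mul_of_nonneg_left ?_ hκ2.le
    unfold mean₁ mean₂
    nlinarith

/-- With `a = √(p11 p00)` and `b = √(p10 p01)`, the covariance is `(a - b) (a + b)`, where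
`a + b ≤ 2 √p11`, while `psi = (a - b) ^ 2`. -/
theorem le_psi_of_mul_sqrt_le_cov (L : PairLaw) {κ : ℝ} (hκ : 0 < κ) (hcov : 0 < L.cov)
    (h : κ * √(L.mean₁ * L.mean₂) ≤ L.cov) : κ ^ 2 / 4 * L.p11 ≤ L.psi := by
  have hp := L.p11_pos_of_cov_pos hcov
  have h1 : κ * L.p11 ≤ L.cov := (mul_le_mul_of_nonneg_left L.p11_le_sqrt hκ.le).trans h
  have h10 := L.p10_nonneg
  have h01 := L.p01_nonneg
  have h00 := L.p00_nonneg
  have hsum := L.sum_eq_one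
  have ha2 := Real.sq_sqrt (mul_nonneg hp.le h00)
  have hb2 := Real.sq_sqrt (mul_nonneg h10 h01)
  have ha0 := Real.sqrt_nonneg (L.p11 * L.p00)
  have hb0 := Real.sqrt_nonneg (L.p10 * L.p01)
  have hcov' := L.mul_sub_mul_eq_cov
  rw [psi]
  generalize √(L.p11 * L.p00) = a at *
  generalize √(L.p10 * L.p01) = b at *
  have hab : b ≤ a := by nlinarith
  have ha : a ^ 2 ≤ L.p11 := by
    rw [ha2]; exact mul_le_of_le_one_right hp.le (by linarith)
  have hfac : L.cov = (a - b) * (a + b) := by rw [← hcov', ← ha2, ← hb2]; ring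
  have h2 : (κ * L.p11) ^ 2 ≤ ((a - b) * (a + b)) ^ 2 := by
    rw [← hfac]
    exact pow_le_pow_left₀ (by positivity) h1 2
  have h3 : ((a - b) * (a + b)) ^ 2 ≤ (a - b) ^ 2 * (4 * L.p11) := by
    rw [mul_pow]
    refine mul_le_mul_of_nonneg_left ?_ (sq_nonneg _)
    nlinarith
  refine le_of_mul_le_mul_right ?_ (by positivity : 0 < 4 * L.p11)
  linarith

end PairLaw

theorem exists_pos_eventually_le_of_isTheta_one {f : ℕ → ℝ} (hf : ∀ n, 0 ≤ f n)
    (h : f =Θ[atTop] fun _ => (1 : ℝ)) : ∃ c > 0, ∀ᶠ n in atTop, c ≤ f n := by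
  obtain ⟨c, hc, hb⟩ := h.2.exists_pos
  refine ⟨c⁻¹, inv_pos.2 hc, hb.bound.mono fun n hn => ?_⟩
  rw [norm_one, Real.norm_of_nonneg (hf n)] at hn
  rwa [inv_le_iff_one_le_mul₀' hc]

/-- At edge density `O(log n / n)` the error terms `n * p ^ (3/2)` and `p` vanish. -/
theorem tendsto_sparse_error {A : ℝ} (hA : 0 ≤ A) (D E : ℝ) :
    Tendsto (fun n : ℕ => (n : ℝ) * (D * √(A * Real.log n / n) ^ 3) + E * (A * Real.log n / n))
      atTop (nhds 0) := by
  have hlog : ∀ k : ℕ, Tendsto (fun n : ℕ => Real.log n ^ k / (n : ℝ)) atTop (nhds 0) := fun k =>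
    (Real.isLittleO_pow_log_id_atTop (n := k)).tendsto_div_nhds_zero.comp
      tendsto_natCast_atTop_atTop
  have h1 : Tendsto (fun n : ℕ => (n : ℝ) * √(A * Real.log n / n) ^ 3) atTop (nhds 0) := by
    have h2 : Tendsto (fun n : ℕ => √(A ^ 3 * (Real.log n ^ 3 / (n : ℝ)))) atTop (nhds 0) := by
      simpa using ((hlog 3).const_mul (A ^ 3)).sqrt
    refine h2.congr' ?_
    filter_upwards [eventually_gt_atTop 0] with n hn
    have hn' : (0 : ℝ) < n := by exact_mod_cast hn
    have hx : 0 ≤ A * Real.log n / n :=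
      div_nonneg (mul_nonneg hA (Real.log_natCast_nonneg n)) hn'.le
    rw [← Real.sqrt_sq (by positivity : 0 ≤ (n : ℝ) * √(A * Real.log n / n) ^ 3)]
    congr 1
    rw [mul_pow, ← pow_mul, mul_comm 3 2, pow_mul, Real.sq_sqrt hx]
    field_simp
  have h3 : Tendsto (fun n : ℕ => A * Real.log n / (n : ℝ)) atTop (nhds 0) := by
    simpa [mul_div_assoc] using (hlog 1).const_mul A
  have h4 := (h1.const_mul D).add (h3.const_mul E)
  simp only [mul_zero, add_zero] at h4
  exact h4.congr fun n => by ring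

end

end AttributedAlignment

open AttributedAlignment in
/-- Exact alignment of the attributed Erdős–Rényi pair `G(n, p n; m n, q n)`: under the stated
conditions some estimator, and indeed every MAP estimator, recovers the hidden permutation with
probability tending to one. -/
theorem theorem1 (m : ℕ → ℕ) (p q : ℕ → PairLaw)
    (hp_pos : ∀ n, 0 < (p n).corr)
    (hq_nonneg : ∀ n, 0 ≤ (q n).cov)
    (hp₁ : (fun n => 1 - ((p n).p11 + (p n).p10)) =Θ[atTop] (fun _ => (1 : ℝ)))
    (hp₂ : (fun n => 1 - ((p n).p11 + (p n).p01)) =Θ[atTop] (fun _ => (1 : ℝ)))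
    (hρ : (fun n => (p n).corr) =Θ[atTop] (fun _ => (1 : ℝ)))
    (hlim : Tendsto (fun n : ℕ => (n : ℝ) * (p n).p11 + (m n : ℝ) * (q n).psi - Real.log n)
      atTop atTop) :
    (∃ est : ∀ n, Estimator n (m n),
      Tendsto (fun n => errorProb (p n) (q n) (est n)) atTop (nhds 0)) ∧
    (∀ est : ∀ n, Estimator n (m n), (∀ n, IsMAP (p n) (q n) (est n)) →
      Tendsto (fun n => errorProb (p n) (q n) (est n)) atTop (nhds 0)) := by
  suffices hmap : ∀ est : ∀ n, Estimator n (m n), (∀ n, IsMAP (p n) (q n) (est n)) →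
      Tendsto (fun n => errorProb (p n) (q n) (est n)) atTop (nhds 0) by
    refine ⟨?_, hmap⟩
    choose est hest using fun n => exists_isMAP (m := m n) (n := n) (p n) (q n)
    exact ⟨est, hmap est hest⟩
  intro est hest
  obtain ⟨c₁, hc₁, h₁⟩ := exists_pos_eventually_le_of_isTheta_one (fun n => by
    linarith [(p n).p01_nonneg, (p n).p00_nonneg, (p n).sum_eq_one]) hp₁
  obtain ⟨c₂, hc₂, h₂⟩ := exists_pos_eventually_le_of_isTheta_one (fun n => by
    linarith [(p n).p10_nonneg, (p n).p00_nonneg, (p n).sum_eq_one]) hp₂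
  obtain ⟨c₃, hc₃, h₃⟩ := exists_pos_eventually_le_of_isTheta_one (fun n => (hp_pos n).le) hρ
  obtain ⟨c, hc, hcc₁, hcc₂, hcc₃⟩ : ∃ c > 0, c ≤ c₁ ∧ c ≤ c₂ ∧ c ≤ c₃ :=
    ⟨min c₁ (min c₂ c₃), by positivity, min_le_left _ _,
      (min_le_right _ _).trans (min_le_left _ _), (min_le_right _ _).trans (min_le_right _ _)⟩
  set κ := c ^ 2 with hκdef
  have hκ : 0 < κ := by positivity
  -- A constant for the `p11 ^ (3/2)` error that serves both `z = 1` and `z = exp 4`.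
  obtain ⟨D, hD0, hD⟩ : ∃ D : ℝ, 0 ≤ D ∧ ∀ L : PairLaw, √L.p10 ≤ κ⁻¹ * √L.p11 →
      √L.p01 ≤ κ⁻¹ * √L.p11 → ∀ z, 0 ≤ z → z ≤ Real.exp 4 →
      hsNorm (L.overlap z) ≤ Real.exp (-(L.p11 - D * √L.p11 ^ 3)) := by
    set k := κ⁻¹
    have hk : 0 ≤ k := (inv_pos.2 hκ).le
    refine ⟨((Real.exp 4 + k ^ 2) ^ 2 + Real.exp 4 ^ 2 * k ^ 2 + 2 * Real.exp 4 * k ^ 2 +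
      3 * k ^ 2 + (1 + k ^ 2) ^ 2) / 2, by positivity, fun L h10 h01 z hz hz4 => ?_⟩
    refine (L.hsNorm_overlap_le hz hk h10 h01).trans (Real.exp_le_exp.2 (neg_le_neg ?_))
    gcongr
  -- The density `A * log n / n` separates the dense from the sparse regime.
  set A := 32 / κ ^ 2 with hA
  have hA0 : 0 ≤ A := by positivity
  set s : ℕ → ℝ := fun n => n * (p n).p11 + m n * (q n).psi - Real.log n with hs
  have hlim0 : Tendsto (fun n : ℕ => 2 / (n : ℝ) + (32 / s n + 2 * Real.exp (1 - s n / 2)))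
      atTop (nhds 0) := by
    have h1 : Tendsto (fun n : ℕ => 2 / (n : ℝ)) atTop (nhds 0) :=
      tendsto_const_nhds.div_atTop tendsto_natCast_atTop_atTop
    have h2 : Tendsto (fun n => 32 / s n) atTop (nhds 0) := tendsto_const_nhds.div_atTop hlim
    have h3 : Tendsto (fun n => Real.exp (1 - s n / 2)) atTop (nhds 0) := by
      refine Real.tendsto_exp_atBot.comp ?_
      exact tendsto_atBot_add_const_left _ _
        (tendsto_neg_atTop_atBot.comp (hlim.atTop_div_const two_pos))
    simpa using h1.add (h2.add (h3.const_mul 2))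
  refine squeeze_zero' (Eventually.of_forall fun n => errorProb_nonneg _ _ _) ?_ hlim0
  filter_upwards [h₁, h₂, h₃, hlim.eventually_ge_atTop 32, eventually_ge_atTop 6,
    (tendsto_sparse_error hA0 D (Real.exp 4 + 1)).eventually_le_const one_pos]
    with n h₁ h₂ h₃ hs32 hn6 herr
  have hn : (6 : ℝ) ≤ n := by exact_mod_cast hn6
  have hcov := (p n).mul_sqrt_le_cov hc (hcc₁.trans h₁) (hcc₂.trans h₂) (hcc₃.trans h₃)
  have hcov0 : 0 < (p n).cov := by
    by_contra hneg
    refine absurd (hp_pos n) (not_lt.2 ?_)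
    exact div_nonpos_of_nonpos_of_nonneg (not_lt.1 hneg) (by positivity)
  have hlog : 0 ≤ Real.log n := Real.log_nonneg (by linarith)
  have hpn := (p n).p11_nonneg
  rcases le_total (A * Real.log n / n) (p n).p11 with hdense | hsparse
  · have hpsi := (p n).le_psi_of_mul_sqrt_le_cov hκ hcov0 hcov
    refine (errorProb_le_of_dense (p n) (q n) (est n) (hest n) (by omega) ?_).trans
      (le_add_of_nonneg_right ?_)
    · have h1 : 8 * Real.log n / n ≤ (p n).psi := by
        refine le_trans (le_of_eq ?_) ((mul_le_mul_of_nonneg_left hdense (by positivity)).trans hpsi)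
        rw [hA]
        field_simp
        ring
      calc 2 * Real.log n = 8 * Real.log n / n * (n / 4) := by field_simp; ring
        _ ≤ (p n).psi * ((n - 3) / 2) :=
          mul_le_mul h1 (by linarith) (by positivity) (sq_nonneg _)
    · have : 0 < s n := by linarith
      positivity
  · obtain ⟨h10, h01⟩ := (p n).sqrt_le_of_mul_sqrt_le_cov hκ hcov0 hcov
    refine (errorProb_le_of_sparse (p n) (q n) (est n) (hest n) (by omega) hs32 (by positivity)
      le_rfl (hD _ h10 h01 1 zero_le_one (Real.one_le_exp (by norm_num)))
      (hD _ h10 h01 _ (Real.exp_pos _).le le_rfl) ?_).trans (le_add_of_nonneg_left (by positivity))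
    refine le_trans ?_ herr
    gcongr
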